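/- Let $\Omega=\{\omega_1,\dots,\omega_n\}$ be an ordered finite set of states. A (finite) experiment $f$ with $m\ge 2$ ordered signals is an $n\times m$ matrix $(f_i^j)$ of nonnegative reals with every row sum equal to $1$; $f^j\in[0,1]^n$ is its $j$-th column, and $\mathcal E$ is the set of all finite experiments. $f$ satisfies the MLRP if $f_i^j f_{i'}^{j'}\ge f_{i'}^j f_i^{j'}$ for all $i<i'$ and $j<j'$. Let $\tilde F(\cdot|\omega_i)$ be the distribution function on $[0,m]$ obtained by spreading signal $j$ uniformly over $[j-1,j]$, that is, $\tilde F(x|\omega_i)=\sum_{j=1}^m f_i^j\,\max\{0,\min\{1,x-j+1\}\}$, and let $\tilde F^{-1}(t|\omega_i)=\inf\{x\in[0,m]: \tilde F(x|\omega_i)\ge t,\ \tilde F(x|\omega_i)>0\}$ for $t\in[0,1]$ (the usual quantile function for $t>0$, and its right limit, the lower end point of the support, at $t=0$). For MLRP experiments $f$ and $g$ with $m$ and $m'$ signals, $f$ is Lehmann more informative than $g$ if for every $y\in[0,m']$ the value $\tilde F^{-1}(\tilde G(y|\omega_i)|\omega_i)$ is weakly increasing in $i$. A cost function $C:\mathcal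 E\to\mathbb R_+$ is Lehmann monotone if $C(f)\ge C(g)$ for all MLRP experiments $f,g$ such that $f$ is Lehmann more informative than $g$. $C$ is the likelihood separable cost generated by $\psi:[0,1]^n\to\mathbb R_+$ if $\psi$ is differentiable on $[0,1]^n\setminus\{0\}$ and $C(f)=\sum_{j=1}^m\psi(f^j)-\psi(\mathbf 1)$ for every experiment $f$ with $m$ signals. $\psi$ is sublinear if $\psi(\gamma h)=\gamma\psi(h)$ whenever $\gamma\ge 0$ and $h,\gamma h\in[0,1]^n$, and $\psi(h+h')\le\psi(h)+\psi(h')$ whenever $h,h',h+h'\in[0,1]^n$. (i) There exist likelihood separable costs generated by sublinear $\psi$ that are not Lehmann monotone; indeed $\psi$ can be taken of the form $\psi(h)=\sqrt{h^{\top}Ah}$ with $A$ a symmetric positive definite matrix. (ii) Let $p>1$, let $w_1,\dots,w_n>0$, and let $\psi(h)=\bigl(\sum_{i=1}^n w_ih_i^p\bigr)^{1/p}$ be the weighted $p$-norm. Then $\psi$ generates a likelihood separable cost, and this cost is Lehmann monotone. -/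

import Mathlib

open scoped NNReal

noncomputable section

namespace InfoCost

/-- A finite statistical experiment over the `n` ordered states `Fin n`: a number `m ≥ 2` of ordered
signals and an `n × m` stochastic matrix, `prob i j` being the probability of signal `j` in
state `i`. -/
structure Experiment (n : ℕ) where
  m : ℕ
  two_le : 2 ≤ m
  prob : Matrix (Fin n) (Fin m) ℝ
  nonneg : ∀ i j, 0 ≤ prob i j
  sum_eq_one : ∀ i, ∑ j, prob i j = 1

namespace Experiment

variable {n : ℕ}

/-- The `j`-th column of the experiment, a vector in `[0,1]^n`. -/
def col (f : Experiment n) (j : Fin f.m) : Fin n → ℝ := fun i => f.prob i j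

/-- The monotone likelihood ratio property. -/
def MLRP (f : Experiment n) : Prop :=
  ∀ (i i' : Fin n) (j j' : Fin f.m), i < i' → j < j' →
    f.prob i' j * f.prob i j' ≤ f.prob i j * f.prob i' j'

/-- The distribution function, in state `i`, of the continuous experiment on `[0, m]` associated
with `f`, in which the `j`-th signal (counting from `0`) is spread uniformly over `[j, j + 1]`. -/
def cdf (f : Experiment n) (i : Fin n) (x : ℝ) : ℝ :=
  ∑ j : Fin f.m, f.prob i j * max 0 (min 1 (x - (j : ℝ)))

/-- The distribution function is the linear interpolation of the cumulative probabilities. -/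
theorem cdf_eq_interpolation (f : Experiment n) (i : Fin n) (k : Fin f.m) (x : ℝ)
    (h₁ : (k : ℝ) ≤ x) (h₂ : x ≤ (k : ℝ) + 1) :
    f.cdf i x = ∑ j ∈ Finset.Iio k, f.prob i j + (x - (k : ℝ)) * f.prob i k := by
  have hterm : ∀ j : Fin f.m, f.prob i j * max 0 (min 1 (x - (j : ℝ)))
      = (if j ∈ Finset.Iio k then f.prob i j else 0)
        + (if j = k then (x - (k : ℝ)) * f.prob i k else 0) := by
    intro j
    rcases lt_trichotomy j k with h | h | h
    · have h3 : (j : ℝ) + 1 ≤ (k : ℝ) := by exact_mod_cast Nat.succ_le_of_lt h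
      rw [if_pos (Finset.mem_Iio.2 h), if_neg h.ne, min_eq_left (by linarith),
        max_eq_right zero_le_one]
      ring
    · subst h
      rw [if_neg (by simp), if_pos rfl, min_eq_right (by linarith), max_eq_right (by linarith)]
      ring
    · have h3 : (k : ℝ) + 1 ≤ (j : ℝ) := by exact_mod_cast Nat.succ_le_of_lt h
      rw [if_neg (by simpa using h.le), if_neg h.ne',
        max_eq_left ((min_le_right _ _).trans (by linarith))]
      ring
  unfold cdf
  rw [Finset.sum_congr rfl fun j _ => hterm j, Finset.sum_add_distrib, Finset.sum_ite_mem]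
  simp

/-- The inverse of the distribution function `f.cdf i` on `[0, 1]`: the usual quantile function
`t ↦ inf {x | t ≤ F x}` for `0 < t ≤ 1`, and its limit from the right, the lower end point
`inf {x | 0 < F x}` of the support, at `t = 0`. -/
def quantile (f : Experiment n) (i : Fin n) (t : ℝ) : ℝ :=
  sInf {x | x ∈ Set.Icc (0 : ℝ) f.m ∧ t ≤ f.cdf i x ∧ 0 < f.cdf i x}

/-- `f` is Lehmann more informative than `g`. -/
def LehmannGE (f g : Experiment n) : Prop :=
  ∀ y ∈ Set.Icc (0 : ℝ) g.m, Monotone fun i : Fin n => f.quantile i (g.cdf i y)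

end Experiment

variable {n : ℕ}

/-- `C` is Lehmann monotone: on experiments with the monotone likelihood ratio property, a Lehmann
more informative experiment is at least as costly. -/
def LehmannMonotone (C : Experiment n → ℝ≥0) : Prop :=
  ∀ f g : Experiment n, f.MLRP → g.MLRP → f.LehmannGE g → C g ≤ C f

/-- `C` is the likelihood separable cost generated by `ψ : [0,1]^n → ℝ₊`. The function `ψ` is
differentiable away from the origin (at the origin a positively homogeneous function is
differentiable only if it is linear). -/
structure IsLikelihoodSeparable (ψ : (Fin n → ℝ) → ℝ) (C : Experiment n → ℝ≥0) : Prop where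
  nonneg : ∀ h ∈ Set.Icc (0 : Fin n → ℝ) 1, 0 ≤ ψ h
  differentiableOn : DifferentiableOn ℝ ψ (Set.Icc (0 : Fin n → ℝ) 1 \ {0})
  cost_eq : ∀ f : Experiment n, (C f : ℝ) = ∑ j, ψ (f.col j) - ψ 1

/-- Sublinearity of a function on `[0,1]^n`. -/
structure IsSublinear (ψ : (Fin n → ℝ) → ℝ) : Prop where
  homogeneous : ∀ h ∈ Set.Icc (0 : Fin n → ℝ) 1, ∀ γ : ℝ, 0 ≤ γ →
    γ • h ∈ Set.Icc (0 : Fin n → ℝ) 1 → ψ (γ • h) = γ * ψ h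
  subadditive : ∀ h ∈ Set.Icc (0 : Fin n → ℝ) 1, ∀ h' ∈ Set.Icc (0 : Fin n → ℝ) 1,
    h + h' ∈ Set.Icc (0 : Fin n → ℝ) 1 → ψ (h + h') ≤ ψ h + ψ h'

/-- The function `h ↦ √(hᵀ A h)`. -/
def quadNorm (A : Matrix (Fin n) (Fin n) ℝ) (h : Fin n → ℝ) : ℝ :=
  Real.sqrt (h ⬝ᵥ A.mulVec h)

/-- The weighted `p`-norm on nonnegative vectors. -/
def weightedPNorm (w : Fin n → ℝ) (p : ℝ) (h : Fin n → ℝ) : ℝ :=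
  (∑ i, w i * h i ^ p) ^ (1 / p)

end InfoCost

end

noncomputable section

namespace InfoCost

open Finset MeasureTheory

variable {n : ℕ}

/-! ### Distribution functions, quantiles and columns. -/

namespace Experiment

/-! By Hölder's inequality the weighted `p`-norm is a support function: its value at `h` is the
maximum of `∑ h i * u i` over payoff vectors `u i = w i * r i ^ (p - 1)` with `r ≥ 0` in the unit
ball, attained at the normalization of `h`. Hence the sum of the norms of the columns of `g` is the
value of `g` in a decision problem.

MLRP makes the optimal actions of `g` single crossing (`Experiment.MLRP.singleCrossing`). Matching
quantiles of `f` and `g` state by state reproduces the payoff of `g` in every state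
(`sum_mul_eq_sum_setIntegral`), but by a rule that depends on the state. The Lehmann order says
that, at a fixed signal of `f`, this rule takes weakly lower actions in higher states;
`exists_dominating_action` then supplies one action that does as well in all states. Integrating
over the signals of `f` gives the inequality.

The counterexample uses a quadratic norm with a heavy penalty on the second difference across three
states: an experiment with columns affine in the state costs less than a Lehmann less informative
one with bent columns. -/

theorem continuous_cdf (f : Experiment n) (i : Fin n) : Continuous (f.cdf i) := by
  unfold cdf
  fun_prop

theorem cdf_mono (f : Experiment n) (i : Fin n) : Monotone (f.cdf i) := by
  intro x y hxy
  unfold cdf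
  gcongr with j
  exact f.nonneg i j

theorem cdf_of_nonpos (f : Experiment n) (i : Fin n) {x : ℝ} (hx : x ≤ 0) : f.cdf i x = 0 := by
  unfold cdf
  refine Finset.sum_eq_zero fun j _ => ?_
  have hj : (0 : ℝ) ≤ j := Nat.cast_nonneg _
  rw [max_eq_left ((min_le_right _ _).trans (by linarith)), mul_zero]

theorem cdf_of_le (f : Experiment n) (i : Fin n) {x : ℝ} (hx : (f.m : ℝ) ≤ x) :
    f.cdf i x = 1 := by
  refine Eq.trans ?_ (f.sum_eq_one i)
  refine Finset.sum_congr rfl fun j _ => ?_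
  have hj : (j : ℝ) + 1 ≤ f.m := by exact_mod_cast j.2
  rw [min_eq_left (by linarith), max_eq_right zero_le_one, mul_one]

theorem cdf_nonneg (f : Experiment n) (i : Fin n) (x : ℝ) : 0 ≤ f.cdf i x :=
  Finset.sum_nonneg fun j _ => mul_nonneg (f.nonneg i j) (le_max_left _ _)

theorem cdf_le_one (f : Experiment n) (i : Fin n) (x : ℝ) : f.cdf i x ≤ 1 := by
  rw [← f.cdf_of_le i (le_max_right x f.m)]
  exact f.cdf_mono i (le_max_left _ _)

theorem m_mem_quantile_set (f : Experiment n) (i : Fin n) {t : ℝ} (ht : t ≤ 1) :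
    (f.m : ℝ) ∈ {x | x ∈ Set.Icc (0 : ℝ) f.m ∧ t ≤ f.cdf i x ∧ 0 < f.cdf i x} := by
  have h := f.cdf_of_le i le_rfl
  exact ⟨⟨Nat.cast_nonneg _, le_rfl⟩, by rw [h]; exact ht, by rw [h]; exact one_pos⟩

theorem bddBelow_quantile_set (f : Experiment n) (i : Fin n) (t : ℝ) :
    BddBelow {x | x ∈ Set.Icc (0 : ℝ) f.m ∧ t ≤ f.cdf i x ∧ 0 < f.cdf i x} :=
  ⟨0, fun _ hx => hx.1.1⟩

theorem quantile_mono (f : Experiment n) (i : Fin n) {s t : ℝ} (hst : s ≤ t) (ht : t ≤ 1) :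
    f.quantile i s ≤ f.quantile i t :=
  csInf_le_csInf (f.bddBelow_quantile_set i s) ⟨_, f.m_mem_quantile_set i ht⟩
    fun _ hx => ⟨hx.1, hst.trans hx.2.1, hx.2.2⟩

theorem cdf_quantile (f : Experiment n) (i : Fin n) {t : ℝ} (h0 : 0 ≤ t) (h1 : t ≤ 1) :
    f.cdf i (f.quantile i t) = t := by
  have hne : {x | x ∈ Set.Icc (0 : ℝ) f.m ∧ t ≤ f.cdf i x ∧ 0 < f.cdf i x}.Nonempty :=
    ⟨_, f.m_mem_quantile_set i h1⟩
  have hbdd := f.bddBelow_quantile_set i t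
  have hq0 : 0 ≤ f.quantile i t := le_csInf hne fun _ hx => hx.1.1
  have hqm : f.quantile i t ≤ f.m := csInf_le hbdd (f.m_mem_quantile_set i h1)
  apply le_antisymm
  · by_contra! hlt
    -- The midpoint is positive even when `t = 0`, so a point where it is attained lies in the set
    -- defining the quantile.
    have hmem : (t + f.cdf i (f.quantile i t)) / 2 ∈
        Set.Icc (f.cdf i 0) (f.cdf i (f.quantile i t)) := by
      rw [f.cdf_of_nonpos i le_rfl]
      constructor <;> linarith
    obtain ⟨x, ⟨hx0, hxq⟩, hx⟩ :=
      intermediate_value_Icc hq0 (f.continuous_cdf i).continuousOn hmem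
    have hle : f.quantile i t ≤ x :=
      csInf_le hbdd ⟨⟨hx0, hxq.trans hqm⟩, by rw [hx]; linarith, by rw [hx]; linarith⟩
    have := le_antisymm hle hxq
    rw [← this] at hx
    linarith
  · have hcl : IsClosed {x | t ≤ f.cdf i x} := isClosed_le continuous_const (f.continuous_cdf i)
    exact closure_minimal (fun x hx => hx.2.1) hcl (csInf_mem_closure hne hbdd)

/-- The columns of an experiment, indexed by `ℕ` and extended by zero. -/
def extCol (g : Experiment n) (j : ℕ) (i : Fin n) : ℝ :=
  if h : j < g.m then g.prob i ⟨j, h⟩ else 0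

theorem extCol_fin (g : Experiment n) (j : Fin g.m) : g.extCol j = g.col j := by
  ext i
  simp [extCol, col]

theorem extCol_nonneg (g : Experiment n) (j : ℕ) : 0 ≤ g.extCol j := by
  intro i
  unfold extCol
  split_ifs
  · exact g.nonneg _ _
  · exact le_rfl

theorem sum_extCol (g : Experiment n) (i : Fin n) : ∑ j ∈ range g.m, g.extCol j i = 1 := by
  rw [Finset.sum_range, ← g.sum_eq_one i]
  exact Finset.sum_congr rfl fun j _ => congrFun (g.extCol_fin j) i

/-- Both sides vanish when `j'` is past the last signal. The extension allows actions to be indexed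
by all of `ℕ`. -/
theorem MLRP.extCol {g : Experiment n} (hg : g.MLRP) {i i' : Fin n} {j j' : ℕ} (hi : i < i')
    (hj : j < j') : g.extCol j i' * g.extCol j' i ≤ g.extCol j i * g.extCol j' i' := by
  unfold Experiment.extCol
  by_cases h' : j' < g.m
  · rw [dif_pos h', dif_pos h', dif_pos (hj.trans h'), dif_pos (hj.trans h')]
    exact hg i i' ⟨j, hj.trans h'⟩ ⟨j', h'⟩ hi hj
  · simp [h']

theorem cdf_natCast (g : Experiment n) (i : Fin n) {j : ℕ} (hj : j ≤ g.m) :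
    g.cdf i j = ∑ l ∈ range j, g.extCol l i := by
  have h1 : g.cdf i j
      = ∑ l ∈ range g.m, g.extCol l i * max 0 (min 1 ((j : ℝ) - (l : ℝ))) := by
    rw [Finset.sum_range]
    exact Finset.sum_congr rfl fun l _ => by rw [g.extCol_fin l]; rfl
  rw [h1, ← Finset.sum_subset (Finset.range_subset_range.2 hj)]
  · refine Finset.sum_congr rfl fun l hl => ?_
    have : (l : ℝ) + 1 ≤ j := by exact_mod_cast Finset.mem_range.1 hl
    rw [min_eq_left (by linarith), max_eq_right zero_le_one, mul_one]
  · intro l _ hl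
    have : (j : ℝ) ≤ l := by exact_mod_cast not_lt.1 fun h => hl (Finset.mem_range.2 h)
    rw [max_eq_left ((min_le_right _ _).trans (by linarith)), mul_zero]

end Experiment

/-! ### Expectations as integrals of step functions. -/

/-- Summation by parts against the tail sums of `p`. -/
theorem sum_mul_eq_tail_sums (p U : ℕ → ℝ) (N : ℕ) :
    ∑ j ∈ range (N + 1), p j * U j = U 0 * ∑ l ∈ range (N + 1), p l
      + ∑ j ∈ range N, (U (j + 1) - U j)
        * (∑ l ∈ range (N + 1), p l - ∑ l ∈ range (j + 1), p l) := by
  induction N with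
  | zero => simp [mul_comm]
  | succ N ih =>
    have hU := Finset.sum_range_sub U (N + 1)
    rw [Finset.sum_range_succ, ih, Finset.sum_range_succ p (N + 1),
      Finset.sum_range_succ (fun j => (U (j + 1) - U j)
        * (∑ l ∈ range (N + 1), p l + p (N + 1) - ∑ l ∈ range (j + 1), p l)) N]
    have h : ∀ j, (U (j + 1) - U j) * (∑ l ∈ range (N + 1), p l + p (N + 1)
          - ∑ l ∈ range (j + 1), p l)
        = (U (j + 1) - U j) * (∑ l ∈ range (N + 1), p l - ∑ l ∈ range (j + 1), p l)
          + (U (j + 1) - U j) * p (N + 1) := fun j => by ring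
    simp only [h, Finset.sum_add_distrib]
    rw [← Finset.sum_mul]
    rw [Finset.sum_range_succ] at hU
    linear_combination (-p (N + 1)) * hU

theorem integrable_indicator_Ioi (a b c : ℝ) :
    Integrable ((Set.Ioi c).indicator (1 : ℝ → ℝ)) (volume.restrict (Set.Ioc a b)) := by
  rw [integrable_indicator_iff measurableSet_Ioi]
  exact (integrable_const (1 : ℝ)).integrableOn

/-- The subtracted term is the weight of signal `k` in `cdf` at `b`, so averaging over signals
yields `1 - cdf`. -/
theorem setIntegral_indicator_Ioi (k b : ℝ) :
    ∫ x in Set.Ioc k (k + 1), (Set.Ioi b).indicator (1 : ℝ → ℝ) x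
      = 1 - max 0 (min 1 (b - k)) := by
  rw [integral_indicator_one measurableSet_Ioi, measureReal_restrict_apply measurableSet_Ioi,
    Set.inter_comm, Set.Ioc_inter_Ioi, Real.volume_real_Ioc]
  rcases le_total k b with h | h <;> rcases le_total (b - k) 1 with h' | h'
  · rw [max_eq_right h, min_eq_right h', max_eq_right (a := (0 : ℝ)) (by linarith),
      max_eq_left (by linarith)]
    ring
  · rw [max_eq_right h, min_eq_left h', max_eq_right zero_le_one, max_eq_right (by linarith)]
    ring
  · rw [max_eq_left h, min_eq_right h', max_eq_left (a := (0 : ℝ)) (by linarith),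
      max_eq_left (by linarith)]
    ring
  · linarith

/-- The step function with values `U 0, U 1, …` and jumps at the thresholds `b 0, b 1, …`. -/
def stepFun (N : ℕ) (U b : ℕ → ℝ) (x : ℝ) : ℝ :=
  U 0 + ∑ j ∈ range N, (U (j + 1) - U j) * (Set.Ioi (b j)).indicator (1 : ℝ → ℝ) x

theorem integrable_stepFun (N : ℕ) (U b : ℕ → ℝ) (c d : ℝ) :
    Integrable (stepFun N U b) (volume.restrict (Set.Ioc c d)) :=
  (integrable_const _).add
    (integrable_finsetSum _ fun j _ => (integrable_indicator_Ioi c d (b j)).const_mul _)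

theorem setIntegral_stepFun (N : ℕ) (U b : ℕ → ℝ) (k : ℝ) :
    ∫ x in Set.Ioc k (k + 1), stepFun N U b x
      = U 0 + ∑ j ∈ range N, (U (j + 1) - U j) * (1 - max 0 (min 1 (b j - k))) := by
  unfold stepFun
  have hint : ∀ j ∈ range N, Integrable (fun x => (U (j + 1) - U j)
      * (Set.Ioi (b j)).indicator (1 : ℝ → ℝ) x) (volume.restrict (Set.Ioc k (k + 1))) :=
    fun j _ => (integrable_indicator_Ioi _ _ (b j)).const_mul _
  rw [integral_add (integrable_const _) (integrable_finsetSum _ hint), integral_finsetSum _ hint]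
  congr 1
  · simp
  · refine Finset.sum_congr rfl fun j _ => ?_
    rw [integral_const_mul, setIntegral_indicator_Ioi]

theorem stepFun_eq (N : ℕ) (U : ℕ → ℝ) {b : ℕ → ℝ} (hb : MonotoneOn b (Set.Iio N)) (x : ℝ) :
    stepFun N U b x = U #{j ∈ range N | b j < x} := by
  -- Monotone thresholds make the crossed ones an initial segment, over which the jumps telescope.
  have hfilter : {j ∈ range N | b j < x} = range #{j ∈ range N | b j < x} := by
    have hlow : ∀ i j, i ≤ j → j ∈ {j ∈ range N | b j < x} → i ∈ {j ∈ range N | b j < x} := by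
      intro i j hij hj
      rw [Finset.mem_filter, Finset.mem_range] at hj ⊢
      exact ⟨hij.trans_lt hj.1, (hb (hij.trans_lt hj.1) hj.1 hij).trans_lt hj.2⟩
    refine Finset.eq_of_subset_of_card_le (fun j hj => ?_) (by rw [Finset.card_range])
    rw [Finset.mem_range, Nat.lt_iff_add_one_le, ← Finset.card_range (j + 1)]
    refine Finset.card_le_card fun i hi => hlow i j ?_ hj
    exact Nat.lt_succ_iff.1 (Finset.mem_range.1 hi)
  have hsum : ∑ j ∈ range N, (U (j + 1) - U j) * (Set.Ioi (b j)).indicator (1 : ℝ → ℝ) x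
      = ∑ j ∈ {j ∈ range N | b j < x}, (U (j + 1) - U j) := by
    rw [Finset.sum_filter]
    refine Finset.sum_congr rfl fun j _ => ?_
    by_cases h : b j < x <;> simp [Set.indicator, h]
  unfold stepFun
  rw [hsum, hfilter, Finset.sum_range_sub, ← hfilter]
  ring

/-- If `b` matches the quantiles of `f` in state `i` with the partial sums of `p`, then the
expectation of `U` under `p` is an expectation under `f`. -/
theorem sum_mul_eq_sum_setIntegral (f : Experiment n) (i : Fin n) (N : ℕ) (p U b : ℕ → ℝ)
    (hp : ∑ l ∈ range (N + 1), p l = 1)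
    (hb : ∀ j < N, f.cdf i (b j) = ∑ l ∈ range (j + 1), p l) :
    ∑ j ∈ range (N + 1), p j * U j
      = ∑ k, f.prob i k * ∫ x in Set.Ioc (k : ℝ) (k + 1), stepFun N U b x := by
  simp only [setIntegral_stepFun, mul_add, Finset.sum_add_distrib, Finset.mul_sum]
  rw [sum_mul_eq_tail_sums, hp, ← Finset.sum_mul, f.sum_eq_one, Finset.sum_comm]
  congr 1
  · ring
  · refine Finset.sum_congr rfl fun j hj => ?_
    have h1 : 1 - f.cdf i (b j)
        = ∑ k, (f.prob i k - f.prob i k * max 0 (min 1 (b j - (k : ℝ)))) := by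
      rw [Finset.sum_sub_distrib, f.sum_eq_one]
      rfl
    rw [← hb j (Finset.mem_range.1 hj), h1, Finset.mul_sum]
    exact Finset.sum_congr rfl fun k _ => by ring

/-! ### Removing the dependence of the action on the state. -/

/-- If `U` is single crossing, then for every antitone assignment of actions to states some single
action is at least as good in every state. -/
theorem exists_dominating_action (U : ℕ → Fin n → ℝ)
    (hU : ∀ j j', j < j' → ∀ i i', i < i' → U j i < U j' i → U j i' ≤ U j' i')
    (J : Fin n → ℕ) (hJ : Antitone J) : ∃ j, ∀ i, U (J i) i ≤ U j i := by
  -- States are added in increasing order, starting from the largest assigned action. If `j` loses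
  -- at state `k`, switch down to `J k`: had `j` been strictly better at an earlier state, single
  -- crossing would keep it at least as good at `k`.
  have key : ∀ k ≤ n, ∃ j, (∀ i : Fin n, (i : ℕ) < k → U (J i) i ≤ U j i)
      ∧ ∀ i : Fin n, k ≤ i → J i ≤ j := by
    intro k
    induction k with
    | zero =>
      exact fun _ => ⟨Finset.univ.sup J, fun i hi => absurd hi (Nat.not_lt_zero _),
        fun i _ => Finset.le_sup (Finset.mem_univ i)⟩
    | succ k ih =>
      intro hk
      obtain ⟨j, h1, h2⟩ := ih (by omega)
      by_cases h : U (J ⟨k, hk⟩) ⟨k, hk⟩ ≤ U j ⟨k, hk⟩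
      · refine ⟨j, fun i hi => ?_, fun i hi => h2 i (by omega)⟩
        rcases Nat.lt_succ_iff_lt_or_eq.1 hi with hi | hi
        · exact h1 i hi
        · obtain rfl : i = ⟨k, hk⟩ := Fin.ext hi
          exact h
      · refine ⟨J ⟨k, hk⟩, fun i hi => ?_, fun i hi => hJ (Fin.le_def.2 (by simp; omega))⟩
        rcases Nat.lt_succ_iff_lt_or_eq.1 hi with hi | hi
        · refine (h1 i hi).trans ?_
          by_contra! hlt
          have hne : J ⟨k, hk⟩ ≠ j := by
            rintro he
            rw [he] at h
            exact h le_rfl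
          exact h (hU _ _ (lt_of_le_of_ne (h2 ⟨k, hk⟩ le_rfl) hne) i ⟨k, hk⟩ hi hlt)
        · obtain rfl : i = ⟨k, hk⟩ := Fin.ext hi
          exact le_rfl
  obtain ⟨j, hj, -⟩ := key n le_rfl
  exact ⟨j, fun i => hj i i.2⟩

/-! ### The weighted `p`-norm as the value of a decision problem. -/

section WeightedPNorm

variable {w : Fin n → ℝ} {p : ℝ}

theorem weightedPNorm_sum_nonneg (hw : ∀ i, 0 < w i) {h : Fin n → ℝ} (hh : 0 ≤ h) :
    0 ≤ ∑ i, w i * h i ^ p :=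
  Finset.sum_nonneg fun i _ => mul_nonneg (hw i).le (Real.rpow_nonneg (hh i) _)

theorem weightedPNorm_nonneg (hw : ∀ i, 0 < w i) {h : Fin n → ℝ} (hh : 0 ≤ h) :
    0 ≤ weightedPNorm w p h :=
  Real.rpow_nonneg (weightedPNorm_sum_nonneg hw hh) _

theorem weightedPNorm_rpow (hp : 1 < p) (hw : ∀ i, 0 < w i) {h : Fin n → ℝ} (hh : 0 ≤ h) :
    weightedPNorm w p h ^ p = ∑ i, w i * h i ^ p := by
  unfold weightedPNorm
  rw [← Real.rpow_mul (weightedPNorm_sum_nonneg hw hh), one_div_mul_cancel (by linarith),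
    Real.rpow_one]

/-- Hölder's inequality for the weighted `p`-norm. -/
theorem sum_le_weightedPNorm (hp : 1 < p) (hw : ∀ i, 0 < w i) {h r : Fin n → ℝ} (hh : 0 ≤ h)
    (hr : 0 ≤ r) (hr1 : ∑ i, w i * r i ^ p ≤ 1) :
    ∑ i, h i * (w i * r i ^ (p - 1)) ≤ weightedPNorm w p h := by
  have hpq : p.HolderConjugate (p / (p - 1)) := Real.HolderConjugate.conjExponent hp
  have hp0 : p ≠ 0 := by linarith
  have hp1 : p - 1 ≠ 0 := by linarith
  -- Splitting `w = w ^ (1 / p) * w ^ ((p - 1) / p)` reduces to unweighted Hölder.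
  have hH := Real.inner_le_Lp_mul_Lq_of_nonneg Finset.univ hpq
    (f := fun i => w i ^ (1 / p) * h i)
    (g := fun i => w i ^ ((p - 1) / p) * r i ^ (p - 1))
    (fun i _ => mul_nonneg (Real.rpow_nonneg (hw i).le _) (hh i))
    (fun i _ => mul_nonneg (Real.rpow_nonneg (hw i).le _) (Real.rpow_nonneg (hr i) _))
  have e1 : ∀ i, w i ^ (1 / p) * h i * (w i ^ ((p - 1) / p) * r i ^ (p - 1))
      = h i * (w i * r i ^ (p - 1)) := by
    intro i
    have : w i ^ (1 / p) * w i ^ ((p - 1) / p) = w i := by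
      rw [← Real.rpow_add (hw i), ← add_div, add_sub_cancel, div_self hp0, Real.rpow_one]
    linear_combination (h i * r i ^ (p - 1)) * this
  have e2 : ∀ i, (w i ^ (1 / p) * h i) ^ p = w i * h i ^ p := by
    intro i
    rw [Real.mul_rpow (Real.rpow_nonneg (hw i).le _) (hh i), ← Real.rpow_mul (hw i).le,
      one_div_mul_cancel hp0, Real.rpow_one]
  have e3 : ∀ i, (w i ^ ((p - 1) / p) * r i ^ (p - 1)) ^ (p / (p - 1)) = w i * r i ^ p := by
    intro i
    rw [Real.mul_rpow (Real.rpow_nonneg (hw i).le _) (Real.rpow_nonneg (hr i) _),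
      ← Real.rpow_mul (hw i).le, ← Real.rpow_mul (hr i), div_mul_div_cancel₀ hp0,
      div_self hp1, Real.rpow_one, mul_div_cancel₀ _ hp1]
  simp only [e1, e2, e3] at hH
  refine hH.trans ?_
  refine mul_le_of_le_one_right (weightedPNorm_nonneg hw hh) ?_
  exact Real.rpow_le_one (weightedPNorm_sum_nonneg hw hr) hr1 (by
    rw [one_div]; exact inv_nonneg.2 hpq.symm.pos.le)

/-- The normalization of a nonnegative vector. -/
def normalize (w : Fin n → ℝ) (p : ℝ) (h : Fin n → ℝ) (i : Fin n) : ℝ :=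
  h i / weightedPNorm w p h

theorem normalize_nonneg (hw : ∀ i, 0 < w i) {h : Fin n → ℝ} (hh : 0 ≤ h) :
    0 ≤ normalize w p h :=
  fun i => div_nonneg (hh i) (weightedPNorm_nonneg hw hh)

theorem sum_normalize_rpow_le (hp : 1 < p) (hw : ∀ i, 0 < w i) {h : Fin n → ℝ} (hh : 0 ≤ h) :
    ∑ i, w i * normalize w p h i ^ p ≤ 1 := by
  have hN := weightedPNorm_nonneg (p := p) hw hh
  have e : ∀ i, w i * normalize w p h i ^ p
      = w i * h i ^ p / weightedPNorm w p h ^ p := fun i => by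
    rw [normalize, Real.div_rpow (hh i) hN, mul_div_assoc]
  simp only [e]
  rw [← Finset.sum_div, ← weightedPNorm_rpow hp hw hh]
  exact div_self_le_one _

/-- This is the equality case of Hölder. At norm zero the normalization is `0` by division by zero,
and `0 ^ (p - 1) = 0`. -/
theorem sum_mul_normalize (hp : 1 < p) (hw : ∀ i, 0 < w i) {h : Fin n → ℝ} (hh : 0 ≤ h) :
    ∑ i, h i * (w i * normalize w p h i ^ (p - 1)) = weightedPNorm w p h := by
  have hN := weightedPNorm_nonneg (p := p) hw hh
  have hp1 : p - 1 ≠ 0 := by linarith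
  rcases hN.eq_or_lt with h0 | hpos
  · simp [normalize, ← h0, Real.zero_rpow hp1]
  · have e : ∀ i, h i * (w i * normalize w p h i ^ (p - 1))
        = w i * h i ^ p / weightedPNorm w p h ^ (p - 1) := fun i => by
      have : h i ^ p = h i * h i ^ (p - 1) := by
        rw [mul_comm, ← Real.rpow_add_one' (hh i) (by linarith)]
        congr 1
        ring
      rw [normalize, Real.div_rpow (hh i) hN, this]
      ring
    simp only [e]
    rw [← Finset.sum_div, ← weightedPNorm_rpow hp hw hh, ← Real.rpow_sub hpos]
    simp

theorem differentiableOn_weightedPNorm (hp : 1 < p) (hw : ∀ i, 0 < w i) :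
    DifferentiableOn ℝ (weightedPNorm w p) (Set.Icc (0 : Fin n → ℝ) 1 \ {0}) := by
  rintro h ⟨⟨hh, -⟩, hne⟩
  have hpos : 0 < ∑ i, w i * h i ^ p := by
    obtain ⟨i, hi⟩ : ∃ i, h i ≠ 0 := Function.ne_iff.1 hne
    refine Finset.sum_pos' (fun i _ => mul_nonneg (hw i).le (Real.rpow_nonneg (hh i) _))
      ⟨i, Finset.mem_univ i, mul_pos (hw i) (Real.rpow_pos_of_pos ?_ _)⟩
    exact lt_of_le_of_ne (hh i) (Ne.symm hi)
  have hd : DifferentiableAt ℝ (fun h : Fin n → ℝ => ∑ i, w i * h i ^ p) h :=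
    DifferentiableAt.fun_sum fun i _ =>
      ((differentiableAt_apply i h).rpow_const (Or.inr hp.le)).const_mul _
  exact (hd.rpow_const (Or.inl hpos.ne')).differentiableWithinAt

/-- The action optimal without information remains available after every signal. -/
theorem weightedPNorm_one_le (hp : 1 < p) (hw : ∀ i, 0 < w i) (f : Experiment n) :
    weightedPNorm w p 1 ≤ ∑ j, weightedPNorm w p (f.col j) := by
  have h1 : (0 : Fin n → ℝ) ≤ 1 := zero_le_one
  rw [← sum_mul_normalize hp hw h1]
  calc ∑ i, (1 : Fin n → ℝ) i * (w i * normalize w p 1 i ^ (p - 1))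
      = ∑ i, ∑ j, f.col j i * (w i * normalize w p 1 i ^ (p - 1)) := by
        refine Finset.sum_congr rfl fun i _ => ?_
        rw [← Finset.sum_mul]
        congr 1
        exact (f.sum_eq_one i).symm
    _ = ∑ j, ∑ i, f.col j i * (w i * normalize w p 1 i ^ (p - 1)) := Finset.sum_comm
    _ ≤ _ := Finset.sum_le_sum fun j _ => sum_le_weightedPNorm hp hw (fun i => f.nonneg i j)
        (normalize_nonneg hw h1) (sum_normalize_rpow_le hp hw h1)

/-- The optimal actions for an experiment with the monotone likelihood ratio property are single
crossing. -/
theorem Experiment.MLRP.singleCrossing {g : Experiment n} (hg : g.MLRP) (hp : 1 < p)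
    (hw : ∀ i, 0 < w i) {j j' : ℕ} (hj : j < j') {i i' : Fin n} (hi : i < i')
    (h : w i * normalize w p (g.extCol j) i ^ (p - 1)
      < w i * normalize w p (g.extCol j') i ^ (p - 1)) :
    w i' * normalize w p (g.extCol j) i' ^ (p - 1)
      ≤ w i' * normalize w p (g.extCol j') i' ^ (p - 1) := by
  have hp1 : 0 < p - 1 := by linarith
  have h0 : ∀ j, 0 ≤ normalize w p (g.extCol j) := fun j => normalize_nonneg hw (g.extCol_nonneg j)
  have hlt : normalize w p (g.extCol j) i < normalize w p (g.extCol j') i :=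
    lt_of_mul_lt_mul_left h (hw i).le |> (Real.rpow_lt_rpow_iff (h0 j i) (h0 j' i) hp1).1
  refine mul_le_mul_of_nonneg_left (Real.rpow_le_rpow (h0 j i') ?_ hp1.le) (hw i').le
  -- Rescaling columns preserves the likelihood ratio inequality.
  have hm : normalize w p (g.extCol j) i' * normalize w p (g.extCol j') i
      ≤ normalize w p (g.extCol j) i * normalize w p (g.extCol j') i' := by
    unfold normalize
    rw [div_mul_div_comm, div_mul_div_comm]
    exact div_le_div_of_nonneg_right (hg.extCol hi hj) (mul_nonneg
      (weightedPNorm_nonneg hw (g.extCol_nonneg j)) (weightedPNorm_nonneg hw (g.extCol_nonneg j')))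
  have hpos : 0 < normalize w p (g.extCol j') i := (h0 j i).trans_lt hlt
  refine le_of_mul_le_mul_right (hm.trans ?_) hpos
  rw [mul_comm]
  exact mul_le_mul_of_nonneg_left hlt.le (h0 j' i')

theorem Experiment.LehmannGE.sum_weightedPNorm_le {f g : Experiment n} (hfg : f.LehmannGE g)
    (hg : g.MLRP) (hp : 1 < p) (hw : ∀ i, 0 < w i) :
    ∑ j, weightedPNorm w p (g.col j) ≤ ∑ k, weightedPNorm w p (f.col k) := by
  obtain ⟨N, hN⟩ : ∃ N, g.m = N + 1 := ⟨g.m - 1, by have := g.two_le; omega⟩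
  set U : ℕ → Fin n → ℝ := fun j i => w i * normalize w p (g.extCol j) i ^ (p - 1) with hU
  -- Signal `j` ends at `j + 1`; the `N + 1` signals of `g` are separated by `N` thresholds.
  set b : Fin n → ℕ → ℝ := fun i j => f.quantile i (g.cdf i ((j + 1 : ℕ) : ℝ)) with hb
  have hbmono : ∀ i, Monotone (b i) := fun i j j' hjj' =>
    f.quantile_mono i (g.cdf_mono i (by exact_mod_cast Nat.succ_le_succ hjj')) (g.cdf_le_one i _)
  have hcdf : ∀ i, ∀ j < N, f.cdf i (b i j) = ∑ l ∈ range (j + 1), g.extCol l i := by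
    intro i j hj
    rw [hb, f.cdf_quantile i (g.cdf_nonneg i _) (g.cdf_le_one i _), g.cdf_natCast i (by omega)]
  have hpt : ∀ (k : Fin f.m) (x : ℝ),
      ∑ i, f.col k i * stepFun N (fun j => U j i) (b i) x ≤ weightedPNorm w p (f.col k) := by
    intro k x
    -- Thresholds rise with the state, so fewer of them lie below `x`.
    have hJ : Antitone fun i => #{j ∈ range N | b i j < x} := by
      intro i i' hii'
      refine Finset.card_le_card fun j hj => ?_
      rw [Finset.mem_filter] at hj ⊢
      refine ⟨hj.1, lt_of_le_of_lt ?_ hj.2⟩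
      refine hfg _ ⟨Nat.cast_nonneg _, ?_⟩ hii'
      have := Finset.mem_range.1 hj.1
      exact_mod_cast (by omega : j + 1 ≤ g.m)
    obtain ⟨j, hj⟩ := exists_dominating_action U
      (fun j j' hj i i' hi h => hg.singleCrossing hp hw hj hi h) _ hJ
    refine le_trans (Finset.sum_le_sum fun i _ => ?_)
      (sum_le_weightedPNorm hp hw (fun i => f.nonneg i k)
        (normalize_nonneg hw (g.extCol_nonneg j))
        (sum_normalize_rpow_le hp hw (g.extCol_nonneg j)))
    rw [stepFun_eq N _ ((hbmono i).monotoneOn _)]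
    exact mul_le_mul_of_nonneg_left (hj i) (f.nonneg i k)
  calc ∑ j, weightedPNorm w p (g.col j)
      = ∑ j ∈ range (N + 1), weightedPNorm w p (g.extCol j) := by
        rw [← hN, Finset.sum_range]
        exact Finset.sum_congr rfl fun j _ => by rw [g.extCol_fin]
    _ = ∑ j ∈ range (N + 1), ∑ i, g.extCol j i * U j i :=
        Finset.sum_congr rfl fun j _ => (sum_mul_normalize hp hw (g.extCol_nonneg j)).symm
    _ = ∑ i, ∑ k, f.prob i k
          * ∫ x in Set.Ioc (k : ℝ) (k + 1), stepFun N (fun j => U j i) (b i) x := by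
        rw [Finset.sum_comm]
        refine Finset.sum_congr rfl fun i _ => ?_
        exact sum_mul_eq_sum_setIntegral f i N (fun j => g.extCol j i) (fun j => U j i) (b i)
          (hN ▸ g.sum_extCol i) (hcdf i)
    _ = ∑ k : Fin f.m, ∫ x in Set.Ioc (k : ℝ) (k + 1),
          ∑ i, f.col k i * stepFun N (fun j => U j i) (b i) x := by
        rw [Finset.sum_comm]
        refine Finset.sum_congr rfl fun k _ => ?_
        rw [integral_finsetSum _ fun i _ => (integrable_stepFun _ _ _ _ _).const_mul _]
        exact Finset.sum_congr rfl fun i _ => (integral_const_mul _ _).symm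
    _ ≤ ∑ k : Fin f.m, ∫ _ in Set.Ioc (k : ℝ) (k + 1), weightedPNorm w p (f.col k) := by
        refine Finset.sum_le_sum fun k _ => integral_mono ?_ (integrable_const _) (hpt k)
        exact integrable_finsetSum _ fun i _ => (integrable_stepFun _ _ _ _ _).const_mul _
    _ = ∑ k, weightedPNorm w p (f.col k) := by simp

end WeightedPNorm

theorem exists_isLikelihoodSeparable {ψ : (Fin n → ℝ) → ℝ}
    (h0 : ∀ h ∈ Set.Icc (0 : Fin n → ℝ) 1, 0 ≤ ψ h)
    (hd : DifferentiableOn ℝ ψ (Set.Icc (0 : Fin n → ℝ) 1 \ {0}))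
    (h1 : ∀ f : Experiment n, ψ 1 ≤ ∑ j, ψ (f.col j)) :
    ∃ C : Experiment n → ℝ≥0, IsLikelihoodSeparable ψ C :=
  ⟨fun f => ⟨∑ j, ψ (f.col j) - ψ 1, sub_nonneg.2 (h1 f)⟩, h0, hd, fun _ => rfl⟩

/-! ### A quadratic norm that is not Lehmann monotone. -/

section Counterexample

/-- The positive definite matrix `5 v vᵀ + 1` with `v = (1, -2, 1)`. -/
def curvatureMatrix : Matrix (Fin 3) (Fin 3) ℝ :=
  !![6, -10, 5; -10, 21, -10; 5, -10, 6]

theorem dotProduct_curvatureMatrix (h : Fin 3 → ℝ) :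
    h ⬝ᵥ curvatureMatrix.mulVec h
      = h 0 ^ 2 + h 1 ^ 2 + h 2 ^ 2 + 5 * (h 0 - 2 * h 1 + h 2) ^ 2 := by
  simp [curvatureMatrix, dotProduct, Matrix.mulVec, Fin.sum_univ_three]
  ring

theorem dotProduct_curvatureMatrix_pos {h : Fin 3 → ℝ} (hh : h ≠ 0) :
    0 < h ⬝ᵥ curvatureMatrix.mulVec h := by
  rw [dotProduct_curvatureMatrix]
  obtain ⟨i, hi⟩ : ∃ i, h i ≠ 0 := Function.ne_iff.1 hh
  have := pow_pos (abs_pos.2 hi) 2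
  rw [sq_abs] at this
  fin_cases i <;> simp at this <;> positivity

theorem posDef_curvatureMatrix : curvatureMatrix.PosDef := by
  refine Matrix.PosDef.of_dotProduct_mulVec_pos ?_ fun h hh => ?_
  · ext i j
    fin_cases i <;> fin_cases j <;> simp [curvatureMatrix]
  · simpa using dotProduct_curvatureMatrix_pos hh

/-- A linear map into a Euclidean space whose norm is `quadNorm curvatureMatrix`. -/
def curvatureMap : (Fin 3 → ℝ) →ₗ[ℝ] EuclideanSpace ℝ (Fin 4) where
  toFun h := !₂[h 0, h 1, h 2, √5 * (h 0 - 2 * h 1 + h 2)]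
  map_add' h h' := by
    ext i
    fin_cases i <;> simp
    ring
  map_smul' c h := by
    ext i
    fin_cases i <;> simp
    ring

theorem quadNorm_curvatureMatrix (h : Fin 3 → ℝ) :
    quadNorm curvatureMatrix h = ‖curvatureMap h‖ := by
  rw [quadNorm, dotProduct_curvatureMatrix, EuclideanSpace.norm_eq]
  simp [curvatureMap, Fin.sum_univ_four, mul_pow]

theorem isSublinear_quadNorm_curvatureMatrix : IsSublinear (quadNorm curvatureMatrix) where
  homogeneous h _ γ hγ _ := by
    simp only [quadNorm_curvatureMatrix, map_smul, norm_smul, Real.norm_of_nonneg hγ]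
  subadditive h _ h' _ _ := by
    simp only [quadNorm_curvatureMatrix, map_add]
    exact norm_add_le _ _

theorem exists_isLikelihoodSeparable_quadNorm :
    ∃ C : Experiment 3 → ℝ≥0, IsLikelihoodSeparable (quadNorm curvatureMatrix) C := by
  refine exists_isLikelihoodSeparable (fun _ _ => Real.sqrt_nonneg _) ?_ fun f => ?_
  · rintro h ⟨-, hh⟩
    have hpos := (dotProduct_curvatureMatrix_pos hh).ne'
    have hd : DifferentiableAt ℝ (fun h : Fin 3 → ℝ => h ⬝ᵥ curvatureMatrix.mulVec h) h := by
      simp only [dotProduct_curvatureMatrix]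
      fun_prop
    exact (hd.sqrt hpos).differentiableWithinAt
  · have h1 : (1 : Fin 3 → ℝ) = ∑ j, f.col j := by
      ext i
      rw [Finset.sum_apply]
      exact (f.sum_eq_one i).symm
    simp only [quadNorm_curvatureMatrix]
    rw [h1, map_sum]
    exact norm_sum_le _ _

/-- The binary experiment on three states with high-signal probabilities `0, 1/2, c`. -/
def binaryExperiment (c : ℝ) (h0 : 0 ≤ c) (h1 : c ≤ 1) : Experiment 3 where
  m := 2
  two_le := le_rfl
  prob := !![1, 0; 1 / 2, 1 / 2; 1 - c, c]
  nonneg i j := by fin_cases i <;> fin_cases j <;> simp [h0, h1]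
  sum_eq_one i := by fin_cases i <;> norm_num [Fin.sum_univ_two]

theorem binaryExperiment_col_zero {c : ℝ} (h0 : 0 ≤ c) (h1 : c ≤ 1) :
    (binaryExperiment c h0 h1).col (0 : Fin 2) = ![1, 1 / 2, 1 - c] := by
  ext i
  fin_cases i <;> rfl

theorem binaryExperiment_col_one {c : ℝ} (h0 : 0 ≤ c) (h1 : c ≤ 1) :
    (binaryExperiment c h0 h1).col (1 : Fin 2) = ![0, 1 / 2, c] := by
  ext i
  fin_cases i <;> rfl

theorem MLRP_binaryExperiment {c : ℝ} (h : 1 / 2 ≤ c) (h1 : c ≤ 1) :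
    (binaryExperiment c (by linarith) h1).MLRP := by
  intro i i' (j : Fin 2) (j' : Fin 2) hi hj
  have hlt : (j : ℕ) < j' := hj
  have hj' : (j' : ℕ) < 2 := j'.2
  obtain rfl : j = 0 := Fin.ext (by change (j : ℕ) = 0; omega)
  obtain rfl : j' = 1 := Fin.ext (by change (j' : ℕ) = 1; omega)
  change (binaryExperiment c _ h1).col (0 : Fin 2) i' * (binaryExperiment c _ h1).col (1 : Fin 2) i
    ≤ (binaryExperiment c _ h1).col (0 : Fin 2) i * (binaryExperiment c _ h1).col (1 : Fin 2) i'
  rw [binaryExperiment_col_zero, binaryExperiment_col_one]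
  fin_cases i <;> fin_cases i' <;> simp at hi ⊢ <;> linarith

theorem cdf_binaryExperiment {c : ℝ} (h0 : 0 ≤ c) (h1 : c ≤ 1) (i : Fin 3) (x : ℝ) :
    (binaryExperiment c h0 h1).cdf i x
      = ![1, 1 / 2, 1 - c] i * max 0 (min 1 x) + ![0, 1 / 2, c] i * max 0 (min 1 (x - 1)) := by
  rw [← binaryExperiment_col_zero h0 h1, ← binaryExperiment_col_one h0 h1]
  refine (Fin.sum_univ_two (fun j : Fin 2 =>
    (binaryExperiment c h0 h1).col j i * max 0 (min 1 (x - ((j : ℕ) : ℝ))))).trans ?_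
  simp

theorem LehmannGE_binaryExperiment :
    (binaryExperiment 1 zero_le_one le_rfl).LehmannGE
      (binaryExperiment (1 / 2) (by norm_num) (by norm_num)) := by
  set f := binaryExperiment 1 zero_le_one le_rfl with hf
  set g := binaryExperiment (1 / 2) (by norm_num) (by norm_num) with hg
  intro y hy
  have hy' : 0 ≤ y ∧ y ≤ 2 := by simpa [hg, binaryExperiment] using hy
  -- Quantiles are compared through the reverse inclusion of the sets whose infima they are.
  have step : ∀ i i' : Fin 3, (∀ x ∈ Set.Icc (0 : ℝ) f.m, g.cdf i' y ≤ f.cdf i' x →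
      0 < f.cdf i' x → g.cdf i y ≤ f.cdf i x ∧ 0 < f.cdf i x) →
      f.quantile i (g.cdf i y) ≤ f.quantile i' (g.cdf i' y) := fun i i' h =>
    csInf_le_csInf (f.bddBelow_quantile_set i _) ⟨_, f.m_mem_quantile_set i' (g.cdf_le_one i' y)⟩
      fun x hx => ⟨hx.1, h x hx.1 hx.2.1 hx.2.2⟩
  refine Fin.monotone_iff_le_succ.2 fun i => step _ _ fun x hx h1 h2 => ?_
  have hx' : 0 ≤ x ∧ x ≤ 2 := by simpa [hf, binaryExperiment] using hx
  simp only [hf, hg, cdf_binaryExperiment] at h1 h2 ⊢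
  fin_cases i <;> simp at h1 h2 ⊢ <;> grind

/-- The second difference is `0` for `c = 1` and `±1/2` for `c = 1/2`. The squared norms are `5/4`
against `11/4` and `7/4`. -/
theorem quadNorm_col_lt (j : Fin 2) :
    quadNorm curvatureMatrix ((binaryExperiment 1 zero_le_one le_rfl).col j)
      < quadNorm curvatureMatrix
        ((binaryExperiment (1 / 2) (by norm_num) (by norm_num)).col j) := by
  refine Real.sqrt_lt_sqrt ?_ ?_
  · rw [dotProduct_curvatureMatrix]
    positivity
  · rw [dotProduct_curvatureMatrix, dotProduct_curvatureMatrix]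
    obtain rfl | rfl : j = 0 ∨ j = 1 := by omega
    · rw [binaryExperiment_col_zero, binaryExperiment_col_zero]
      norm_num [show ∀ a b c : ℝ, ![a, b, c] 2 = c from fun _ _ _ => rfl]
    · rw [binaryExperiment_col_one, binaryExperiment_col_one]
      norm_num [show ∀ a b c : ℝ, ![a, b, c] 2 = c from fun _ _ _ => rfl]

theorem not_lehmannMonotone_of_quadNorm {C : Experiment 3 → ℝ≥0}
    (hC : IsLikelihoodSeparable (quadNorm curvatureMatrix) C) : ¬ LehmannMonotone C := by
  intro h
  have hle := NNReal.coe_le_coe.2 (h _ _ (MLRP_binaryExperiment (by norm_num) le_rfl)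
    (MLRP_binaryExperiment le_rfl (by norm_num)) LehmannGE_binaryExperiment)
  rw [hC.cost_eq, hC.cost_eq] at hle
  exact absurd (sub_le_sub_iff_right _ |>.1 hle)
    (not_le.2 (Finset.sum_lt_sum_of_nonempty ⟨(0 : Fin 2), Finset.mem_univ _⟩
      fun j _ => quadNorm_col_lt j))

end Counterexample

end InfoCost

end

theorem mainTheorem6 :
    (∃ (n : ℕ) (A : Matrix (Fin n) (Fin n) ℝ) (C : InfoCost.Experiment n → ℝ≥0),
      A.PosDef ∧
      InfoCost.IsSublinear (InfoCost.quadNorm A) ∧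
      InfoCost.IsLikelihoodSeparable (InfoCost.quadNorm A) C ∧
      ¬ InfoCost.LehmannMonotone C) ∧
    (∀ (n : ℕ) (p : ℝ) (w : Fin n → ℝ), 1 < p → (∀ i, 0 < w i) →
      (∃ C : InfoCost.Experiment n → ℝ≥0,
        InfoCost.IsLikelihoodSeparable (InfoCost.weightedPNorm w p) C) ∧
      ∀ C : InfoCost.Experiment n → ℝ≥0,
        InfoCost.IsLikelihoodSeparable (InfoCost.weightedPNorm w p) C →
          InfoCost.LehmannMonotone C) := by
  refine ⟨?_, fun n p w hp hw => ⟨?_, fun C hC f g _ hg hfg => ?_⟩⟩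
  · obtain ⟨C, hC⟩ := InfoCost.exists_isLikelihoodSeparable_quadNorm
    exact ⟨3, InfoCost.curvatureMatrix, C, InfoCost.posDef_curvatureMatrix,
      InfoCost.isSublinear_quadNorm_curvatureMatrix, hC,
      InfoCost.not_lehmannMonotone_of_quadNorm hC⟩
  · exact InfoCost.exists_isLikelihoodSeparable
      (fun h hh => InfoCost.weightedPNorm_nonneg hw hh.1)
      (InfoCost.differentiableOn_weightedPNorm hp hw) (InfoCost.weightedPNorm_one_le hp hw)
  · rw [← NNReal.coe_le_coe, hC.cost_eq, hC.cost_eq]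
    exact sub_le_sub_right (hfg.sum_weightedPNorm_le hg hp hw) _
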